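/- For two permutations $\sigma,\pi$ of $\{1,\dots,n\}$ let $d(\sigma,\pi)=\max_{1\le i\le n}|\sigma(i)-\pi(i)|$ be their Chebyshev distance, and let $P(n,d)$ denote the maximum cardinality of a set $A$ of permutations of $\{1,\dots,n\}$ such that $d(\sigma,\pi)\ge d$ for all distinct $\sigma,\pi\in A$. Then $P(n,n-2)=10$ for every integer $n\ge 5$. -/

import Mathlib

/-- The Chebyshev distance `max_i |σ(i) - π(i)|` of two permutations of `n` symbols.
The symbols `1, …, n` are represented by `Fin n`; the shift by one does not affect differences. -/
def chebyshevDist {n : ℕ} (σ π : Equiv.Perm (Fin n)) : ℕ :=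
  Finset.univ.sup fun i : Fin n => (((σ i : ℕ) : ℤ) - ((π i : ℕ) : ℤ)).natAbs

/-- The pairwise Chebyshev distance `d(A)` of an array (finite set) of permutations: the minimum
distance of two distinct members, and `⊤` if `A` has at most one member. -/
noncomputable def pairwiseDist {n : ℕ} (A : Finset (Equiv.Perm (Fin n))) : ℕ∞ :=
  ⨅ σ ∈ A, ⨅ π ∈ A, ⨅ _ : σ ≠ π, (chebyshevDist σ π : ℕ∞)

/-- `A` is an `(n, d)` permutation array: distinct members are at Chebyshev distance at least `d`. -/
def IsPermArray (n d : ℕ) (A : Finset (Equiv.Perm (Fin n))) : Prop :=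
  (d : ℕ∞) ≤ pairwiseDist A

/-- `P(n, d)`: the maximum cardinality of an `(n, d)` permutation array. -/
noncomputable def maxPermArray (n d : ℕ) : ℕ :=
  sSup {c : ℕ | ∃ A : Finset (Equiv.Perm (Fin n)), IsPermArray n d A ∧ A.card = c}

theorem isPermArray_iff {n d : ℕ} {A : Finset (Equiv.Perm (Fin n))} :
    IsPermArray n d A ↔ ∀ σ ∈ A, ∀ π ∈ A, σ ≠ π → d ≤ chebyshevDist σ π := by
  simp only [IsPermArray, pairwiseDist, le_iInf_iff, Nat.cast_le]

/-- The supremum in the definition of `P(n, d)` is a maximum. -/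
theorem maxPermArray_isGreatest (n d : ℕ) :
    IsGreatest {c : ℕ | ∃ A : Finset (Equiv.Perm (Fin n)), IsPermArray n d A ∧ A.card = c}
      (maxPermArray n d) := by
  have hb : BddAbove {c : ℕ | ∃ A : Finset (Equiv.Perm (Fin n)),
      IsPermArray n d A ∧ A.card = c} := by
    refine ⟨Fintype.card (Equiv.Perm (Fin n)), ?_⟩
    rintro c ⟨A, -, rfl⟩
    exact Finset.card_le_univ A
  exact ⟨Nat.sSup_mem ⟨0, ∅, by simp [isPermArray_iff], rfl⟩ hb, fun c hc => le_csSup hb hc⟩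

/-!
For a permutation `σ` of `n ≥ 5` symbols let `L σ` be the set of positions of the two smallest
values and `H σ` the set of positions of the two largest ones. If two permutations have distance at
least `n - 2`, then some position carries an extreme low value in one of them and an extreme high
value in the other. So the pairs `(L σ, H σ)` of an array are *weakly cross-intersecting*: `L σ`
meets `H π` or `L π` meets `H σ` whenever `σ ≠ π`. The upper bound is the theorem that there are at
most ten weakly cross-intersecting pairs of disjoint sets with at most two elements
(`WeaklyCross.card_le_ten`). The lower bound is an explicit array which uses only five positions for
the four extreme values (`exists_isPermArray_card_eq_ten`).

Suppose that there are eleven such pairs `(L x, H x)`.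

* Eleven pairs separate at most `44` two-element sets of points. As long as there are ten points,
  some two of them are therefore never on opposite sides of a pair and can be identified. This leaves
  nine points, and all sets can be enlarged to have exactly two elements
  (`WeaklyCross.exists_ninePointSystem`).
* Each of the `55` couples of pairs conflicts at some point, and counting these conflicts gives a
  point `p` in at least three of the sets `L x` or at least three of the sets `H x`
  (`NinePointSystem.exists_three_le`). By symmetry `p` lies in `k ≥ 3` first sets and in at most `k`
  second sets.
* The pairs with `L x = {p, a x}` form a tournament, with an arc from `x` to `y` if `a y ∈ H x`.
  Ordering them along a Hamiltonian path and renaming the points in the order of their appearance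
  leaves few possibilities for these `k` pairs (`NinePointSystem.exists_star`).
* For `k ≥ 6` there is no possibility at all. For `k = 3, 4, 5`, of the remaining `11 - k` pairs at
  most `k` have `p` in their second set, so at least `11 - 2 * k` avoid `p` altogether. A search
  through all pairs on nine points shows that the `k` pairs can never be completed in this way
  (`forallGrowth_starMaximal_three` and its companions; the search is evaluated by the kernel).
-/

/-! ### Weakly cross-intersecting families of set pairs -/

/-- The pairs `(L x, H x)` of disjoint finite sets are *weakly cross-intersecting*: for any two
indices, the first set of one pair meets the second set of the other. -/
structure WeaklyCross {κ α : Type*} (L H : κ → Finset α) : Prop where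
  disjoint : ∀ x, Disjoint (L x) (H x)
  cross : ∀ x y, x ≠ y → ¬Disjoint (L x) (H y) ∨ ¬Disjoint (L y) (H x)

theorem WeaklyCross.swap {κ α : Type*} {L H : κ → Finset α} (h : WeaklyCross L H) :
    WeaklyCross H L where
  disjoint x := (h.disjoint x).symm
  cross x y hxy := by
    rcases h.cross x y hxy with h | h
    · exact Or.inr fun h' => h h'.symm
    · exact Or.inl fun h' => h h'.symm

theorem not_disjoint_image {α β : Type*} [DecidableEq β] {s t : Finset α} (f : α → β)
    (h : ¬Disjoint s t) : ¬Disjoint (s.image f) (t.image f) := by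
  obtain ⟨a, ha, hb⟩ := Finset.not_disjoint_iff.1 h
  exact Finset.not_disjoint_iff.2
    ⟨f a, Finset.mem_image_of_mem f ha, Finset.mem_image_of_mem f hb⟩

theorem WeaklyCross.image {κ α β : Type*} [DecidableEq β] {L H : κ → Finset α}
    (h : WeaklyCross L H) (f : α → β) (hf : ∀ x, Disjoint ((L x).image f) ((H x).image f)) :
    WeaklyCross (fun x => (L x).image f) (fun x => (H x).image f) where
  disjoint := hf
  cross x y hxy := (h.cross x y hxy).imp (not_disjoint_image f) (not_disjoint_image f)

/-- The set of all points used by a family of set pairs. -/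
def support {κ α : Type*} [Fintype κ] [DecidableEq α] (L H : κ → Finset α) : Finset α :=
  Finset.univ.biUnion fun x => L x ∪ H x

theorem left_subset_support {κ α : Type*} [Fintype κ] [DecidableEq α] (L H : κ → Finset α)
    (x : κ) : L x ⊆ support L H :=
  fun _ ha => Finset.mem_biUnion.2 ⟨x, Finset.mem_univ x, Finset.mem_union_left _ ha⟩

theorem right_subset_support {κ α : Type*} [Fintype κ] [DecidableEq α] (L H : κ → Finset α)
    (x : κ) : H x ⊆ support L H :=
  fun _ ha => Finset.mem_biUnion.2 ⟨x, Finset.mem_univ x, Finset.mem_union_right _ ha⟩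

theorem support_image {κ α β : Type*} [Fintype κ] [DecidableEq α] [DecidableEq β]
    (L H : κ → Finset α) (f : α → β) :
    support (fun x => (L x).image f) (fun x => (H x).image f) = (support L H).image f := by
  ext b
  simp only [support, ← Finset.image_union, Finset.mem_biUnion, Finset.mem_image,
    Finset.mem_univ, true_and]
  constructor
  · rintro ⟨x, a, ha, rfl⟩
    exact ⟨a, ⟨x, ha⟩, rfl⟩
  · rintro ⟨a, ⟨x, ha⟩, rfl⟩
    exact ⟨x, a, ha, rfl⟩

/-- Eleven pairs separate at most `11 * 4 = 44` two-element sets, and ten points have `45`. -/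
theorem exists_unseparated {κ : Type*} [Fintype κ] (hκ : Fintype.card κ = 11)
    (L H : κ → Finset ℕ) (hL : ∀ x, (L x).card ≤ 2) (hH : ∀ x, (H x).card ≤ 2)
    (hU : 10 ≤ (support L H).card) :
    ∃ p ∈ support L H, ∃ q ∈ support L H, p ≠ q ∧
      ∀ x, ¬(p ∈ L x ∧ q ∈ H x) ∧ ¬(q ∈ L x ∧ p ∈ H x) := by
  by_contra! hcon
  have hsub : (support L H).powersetCard 2 ⊆ Finset.univ.biUnion fun x =>
      (L x ×ˢ H x).image fun pq => ({pq.1, pq.2} : Finset ℕ) := by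
    intro s hs
    obtain ⟨hsU, hs2⟩ := Finset.mem_powersetCard.1 hs
    obtain ⟨p, q, hpq, rfl⟩ := Finset.card_eq_two.1 hs2
    obtain ⟨x, hx⟩ := hcon p (hsU (by simp)) q (hsU (by simp)) hpq
    simp only [Finset.mem_biUnion, Finset.mem_univ, true_and, Finset.mem_image,
      Finset.mem_product, Prod.exists]
    by_cases h1 : p ∈ L x ∧ q ∈ H x
    · exact ⟨x, p, q, h1, rfl⟩
    · exact ⟨x, q, p, hx fun a b => h1 ⟨a, b⟩, Finset.pair_comm q p⟩
  have h1 := Finset.card_le_card hsub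
  have h2 : (Finset.univ.biUnion fun x =>
      (L x ×ˢ H x).image fun pq => ({pq.1, pq.2} : Finset ℕ)).card ≤
      (Finset.univ : Finset κ).card * 4 := by
    refine Finset.card_biUnion_le_card_mul _ _ _ fun x _ => ?_
    refine Finset.card_image_le.trans ?_
    rw [Finset.card_product]
    exact Nat.mul_le_mul (hL x) (hH x)
  rw [Finset.card_univ, hκ] at h2
  rw [Finset.card_powersetCard] at h1
  have h3 : Nat.choose 10 2 ≤ (support L H).card.choose 2 := Nat.choose_le_choose 2 hU
  have h4 : Nat.choose 10 2 = 45 := by decide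
  omega

/-- Identifying two points that no pair separates keeps the family weakly cross-intersecting, so
the points of eleven pairs of at most two-element sets can be mapped to nine points. -/
theorem WeaklyCross.exists_image_card_le {κ : Type*} [Fintype κ] (hκ : Fintype.card κ = 11)
    (n : ℕ) {L H : κ → Finset ℕ} (h : WeaklyCross L H)
    (hL : ∀ x, (L x).card ≤ 2) (hH : ∀ x, (H x).card ≤ 2) (hn : (support L H).card ≤ n) :
    ∃ f : ℕ → ℕ, WeaklyCross (fun x => (L x).image f) (fun x => (H x).image f) ∧
      ((support L H).image f).card ≤ 9 := by
  induction n generalizing L H with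
  | zero =>
    exact ⟨id, by simpa using h, by simpa using hn.trans (by norm_num : 0 ≤ 9)⟩
  | succ n ih =>
    by_cases hU : (support L H).card ≤ 9
    · exact ⟨id, by simpa using h, by simpa using hU⟩
    obtain ⟨p, hp, q, hq, hpq, hsep⟩ := exists_unseparated hκ L H hL hH (by omega)
    let g : ℕ → ℕ := Function.update id q p
    have hgq : g q = p := by simp [g]
    have hg : ∀ a, a ≠ q → g a = a := fun a ha => by simp [g, ha]
    have hdisj : ∀ x, Disjoint ((L x).image g) ((H x).image g) := by
      intro x
      rw [Finset.disjoint_left]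
      rintro c hc hc'
      obtain ⟨a, ha, rfl⟩ := Finset.mem_image.1 hc
      obtain ⟨b, hb, hab⟩ := Finset.mem_image.1 hc'
      have hne : a ≠ b := fun e => Finset.disjoint_left.1 (h.disjoint x) ha (e ▸ hb)
      by_cases haq : a = q
      · subst haq
        have hbp : b = p := by rw [← hg b (Ne.symm hne), hab, hgq]
        exact (hsep x).2 ⟨ha, hbp ▸ hb⟩
      · by_cases hbq : b = q
        · subst hbq
          have hap : a = p := by rw [← hg a haq, ← hab, hgq]
          exact (hsep x).1 ⟨hap ▸ ha, hb⟩
        · rw [hg a haq, hg b hbq] at hab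
          exact hne hab.symm
    have hcard : ((support L H).image g).card ≤ n := by
      have : (support L H).image g ⊆ (support L H).erase q := by
        intro c hc
        obtain ⟨a, ha, rfl⟩ := Finset.mem_image.1 hc
        by_cases haq : a = q
        · rw [haq, hgq]
          exact Finset.mem_erase.2 ⟨hpq, hp⟩
        · rw [hg a haq]
          exact Finset.mem_erase.2 ⟨haq, ha⟩
      have := Finset.card_le_card this
      rw [Finset.card_erase_of_mem hq] at this
      omega
    obtain ⟨f, hf, hf9⟩ := ih (h.image g hdisj) (fun x => Finset.card_image_le.trans (hL x))
      (fun x => Finset.card_image_le.trans (hH x)) (by rwa [support_image])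
    refine ⟨f ∘ g, ?_, ?_⟩
    · simpa only [Finset.image_image] using hf
    · simpa only [support_image, Finset.image_image] using hf9

/-- A weakly cross-intersecting family of pairs of two-element sets of numbers below nine. -/
structure NinePointSystem {κ : Type*} (L H : κ → Finset ℕ) : Prop extends WeaklyCross L H where
  card_left : ∀ x, (L x).card = 2
  card_right : ∀ x, (H x).card = 2
  left_lt : ∀ x, ∀ p ∈ L x, p < 9
  right_lt : ∀ x, ∀ p ∈ H x, p < 9

theorem NinePointSystem.symm {κ : Type*} {L H : κ → Finset ℕ} (h : NinePointSystem L H) :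
    NinePointSystem H L :=
  ⟨h.swap, h.card_right, h.card_left, h.right_lt, h.left_lt⟩

theorem NinePointSystem.perm {κ : Type*} {L H : κ → Finset ℕ} (h : NinePointSystem L H)
    (σ : Equiv.Perm ℕ) (hσ : ∀ p, p < 9 → σ p < 9) :
    NinePointSystem (fun x => (L x).image σ) (fun x => (H x).image σ) where
  toWeaklyCross := h.image σ fun x => by
    rw [Finset.disjoint_image σ.injective]
    exact h.disjoint x
  card_left x := by rw [Finset.card_image_of_injective _ σ.injective, h.card_left]
  card_right x := by rw [Finset.card_image_of_injective _ σ.injective, h.card_right]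
  left_lt x p hp := by
    obtain ⟨q, hq, rfl⟩ := Finset.mem_image.1 hp
    exact hσ q (h.left_lt x q hq)
  right_lt x p hp := by
    obtain ⟨q, hq, rfl⟩ := Finset.mem_image.1 hp
    exact hσ q (h.right_lt x q hq)

/-- Enlarging the sets of a weakly cross-intersecting family keeps it weakly cross-intersecting as
long as the two sets of each pair remain disjoint; nine points leave room for this. -/
theorem WeaklyCross.exists_ninePointSystem {κ : Type*} [Fintype κ] (hκ : Fintype.card κ = 11)
    {L H : κ → Finset ℕ} (h : WeaklyCross L H)
    (hL : ∀ x, (L x).card ≤ 2) (hH : ∀ x, (H x).card ≤ 2) :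
    ∃ L' H' : κ → Finset ℕ, NinePointSystem L' H' := by
  obtain ⟨f, hf, hf9⟩ := h.exists_image_card_le hκ _ hL hH le_rfl
  set U := (support L H).image f with hU
  obtain ⟨g, hgU, hg⟩ : ∃ g : ℕ → ℕ, (∀ a ∈ U, g a < 9) ∧ Set.InjOn g U := by
    refine ⟨fun a => if ha : a ∈ U then (U.equivFin ⟨a, ha⟩ : ℕ) else 0, ?_, ?_⟩
    · intro a ha
      simp only [ha, dite_true]
      exact (U.equivFin ⟨a, ha⟩).2.trans_le hf9
    · intro a ha b hb hab
      have ha' : a ∈ U := ha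
      have hb' : b ∈ U := hb
      simp only [ha', hb', dite_true] at hab
      have := U.equivFin.injective (Fin.ext hab)
      exact congrArg Subtype.val this
  have hLU : ∀ x, (L x).image f ⊆ U := fun x =>
    Finset.image_subset_image (left_subset_support L H x)
  have hHU : ∀ x, (H x).image f ⊆ U := fun x =>
    Finset.image_subset_image (right_subset_support L H x)
  have hg' : WeaklyCross (fun x => ((L x).image f).image g) (fun x => ((H x).image f).image g) := by
    refine hf.image g fun x => ?_
    rw [Finset.disjoint_left]
    rintro c hc hc'
    obtain ⟨a, ha, rfl⟩ := Finset.mem_image.1 hc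
    obtain ⟨b, hb, hab⟩ := Finset.mem_image.1 hc'
    have : b = a := hg (hHU x hb) (hLU x ha) hab
    exact Finset.disjoint_left.1 (hf.disjoint x) ha (this ▸ hb)
  have hext : ∀ x, ∃ l r : Finset ℕ, ((L x).image f).image g ⊆ l ∧ ((H x).image f).image g ⊆ r ∧
      Disjoint l r ∧ l.card = 2 ∧ r.card = 2 ∧ l ⊆ Finset.range 9 ∧ r ⊆ Finset.range 9 := by
    intro x
    have hl9 : ((L x).image f).image g ⊆ Finset.range 9 := by
      intro c hc
      obtain ⟨a, ha, rfl⟩ := Finset.mem_image.1 hc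
      exact Finset.mem_range.2 (hgU a (hLU x ha))
    have hr9 : ((H x).image f).image g ⊆ Finset.range 9 := by
      intro c hc
      obtain ⟨a, ha, rfl⟩ := Finset.mem_image.1 hc
      exact Finset.mem_range.2 (hgU a (hHU x ha))
    have hl2 : (((L x).image f).image g).card ≤ 2 :=
      Finset.card_image_le.trans (Finset.card_image_le.trans (hL x))
    have hr2 : (((H x).image f).image g).card ≤ 2 :=
      Finset.card_image_le.trans (Finset.card_image_le.trans (hH x))
    obtain ⟨l, hl, hl', hlc⟩ := Finset.exists_subsuperset_card_eq
      (Finset.subset_sdiff.2 ⟨hl9, hg'.disjoint x⟩) hl2 (by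
        rw [Finset.card_sdiff_of_subset hr9, Finset.card_range]
        omega)
    obtain ⟨hl9', hlr⟩ := Finset.subset_sdiff.1 hl'
    obtain ⟨r, hr, hr', hrc⟩ := Finset.exists_subsuperset_card_eq
      (Finset.subset_sdiff.2 ⟨hr9, hlr.symm⟩) hr2 (by
        rw [Finset.card_sdiff_of_subset hl9', Finset.card_range]
        omega)
    obtain ⟨hr9', hrl⟩ := Finset.subset_sdiff.1 hr'
    exact ⟨l, r, hl, hr, hrl.symm, hlc, hrc, hl9', hr9'⟩
  choose L' H' h1 h2 h3 h4 h5 h6 h7 using hext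
  refine ⟨L', H', ⟨⟨h3, fun x y hxy => ?_⟩, h4, h5, fun x p hp => Finset.mem_range.1 (h6 x hp),
    fun x p hp => Finset.mem_range.1 (h7 x hp)⟩⟩
  exact (hg'.cross x y hxy).imp (fun hd hd' => hd (hd'.mono (h1 x) (h2 y)))
    (fun hd hd' => hd (hd'.mono (h1 y) (h2 x)))

/-! ### A point lying in many sets -/

/-- Every two of the eleven pairs are in conflict at some point, so a point cannot lie in at most
two of the sets on each side: this would account for at most `11 * 2 * 2` of the `55` conflicts. -/
theorem NinePointSystem.exists_three_le {κ : Type*} [Fintype κ] [DecidableEq κ]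
    (hκ : Fintype.card κ = 11) {L H : κ → Finset ℕ} (h : NinePointSystem L H) :
    ∃ p, 3 ≤ (Finset.univ.filter fun x => p ∈ L x).card ∨
      3 ≤ (Finset.univ.filter fun x => p ∈ H x).card := by
  by_contra! hcon
  let R : Finset (κ × κ) := Finset.univ.sigma (fun x =>
    Finset.univ.filter fun y => ¬Disjoint (L x) (H y)) |>.map
      (Equiv.sigmaEquivProd κ κ).toEmbedding
  have hR : R.card ≤ 44 := by
    rw [Finset.card_map, Finset.card_sigma]
    have : ∀ x ∈ (Finset.univ : Finset κ),
        (Finset.univ.filter fun y => ¬Disjoint (L x) (H y)).card ≤ 4 := by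
      intro x _
      have hsub : (Finset.univ.filter fun y => ¬Disjoint (L x) (H y)) ⊆
          (L x).biUnion fun p => Finset.univ.filter fun y => p ∈ H y := by
        intro y hy
        obtain ⟨p, hp, hp'⟩ := Finset.not_disjoint_iff.1 (Finset.mem_filter.1 hy).2
        exact Finset.mem_biUnion.2 ⟨p, hp, Finset.mem_filter.2 ⟨Finset.mem_univ y, hp'⟩⟩
      refine (Finset.card_le_card hsub).trans ?_
      refine (Finset.card_biUnion_le_card_mul _ _ 2 fun p _ => ?_).trans ?_
      · exact Nat.le_of_lt_succ (hcon p).2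
      · rw [h.card_left]
    refine (Finset.sum_le_card_nsmul _ _ 4 this).trans ?_
    rw [Finset.card_univ, hκ]
    norm_num
  have hsub : (Finset.univ : Finset κ).offDiag ⊆ R ∪ R.map (Equiv.prodComm κ κ).toEmbedding := by
    rintro ⟨x, y⟩ hxy
    have hne : x ≠ y := (Finset.mem_offDiag.1 hxy).2.2
    rcases h.cross x y hne with hc | hc
    · exact Finset.mem_union_left _ (by simpa [R] using hc)
    · exact Finset.mem_union_right _ (by simpa [R] using hc)
  have h1 := (Finset.card_le_card hsub).trans (Finset.card_union_le _ _)
  have h2 : (R.map (Equiv.prodComm κ κ).toEmbedding).card = R.card := Finset.card_map _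
  rw [Finset.offDiag_card, Finset.card_univ, hκ] at h1
  omega

/-! ### Searching for cliques in the conflict graph -/

/-- The pair `({a, b}, {c, d})` of sets of numbers below nine as a bit pattern: bits `0` to `8`
hold `{a, b}`, bits `9` to `17` hold `{c, d}`, and bits `18` to `26` hold `{a, b}` once more. -/
def setPairCode (a b c d : ℕ) : ℕ :=
  2 ^ a ||| 2 ^ b ||| 2 ^ (c + 9) ||| 2 ^ (d + 9) ||| 2 ^ (a + 18) ||| 2 ^ (b + 18)

/-- Whether two coded pairs are in conflict. After a shift by nine bits the second set of `z` is
compared with the first set of `w` and the first set of `z` with the second set of `w`. -/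
def crossCode (z w : ℕ) : Bool := !Nat.beq (Nat.land (Nat.shiftRight z 9) w) 0

/-- The members of `l` in conflict with `z`. This and the next two functions are written with
recursors because the kernel evaluates them. -/
def neighbors (z : ℕ) (l : List ℕ) : List ℕ :=
  List.rec [] (fun w _ acc => bif crossCode z w then w :: acc else acc) l

/-- Whether the list has `m` members that are pairwise in conflict. -/
def hasClique : ℕ → List ℕ → Bool :=
  Nat.rec (fun _ => true) fun _ ih l =>
    List.rec false (fun z t r => ih (neighbors z t) || r) l

/-- Whether there are `m + k` pairwise conflicting members of `C ++ Y` of which the first `m` are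
taken from `C`. -/
def hasCliqueTwo (k : ℕ) : ℕ → List ℕ → List ℕ → Bool :=
  Nat.rec (fun C Y => hasClique k (C ++ Y)) fun _ ih C Y =>
    List.rec false (fun z t r => ih (neighbors z t) (neighbors z Y) || r) C

theorem neighbors_eq_filter (z : ℕ) (l : List ℕ) : neighbors z l = l.filter (crossCode z) := by
  induction l with
  | nil => rfl
  | cons w l ih =>
    rw [List.filter_cons, ← ih]
    change (bif crossCode z w then w :: neighbors z l else neighbors z l) = _
    cases crossCode z w <;> rfl

theorem hasClique_succ_cons (m z : ℕ) (t : List ℕ) :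
    hasClique (m + 1) (z :: t) = (hasClique m (neighbors z t) || hasClique (m + 1) t) := rfl

theorem hasCliqueTwo_succ_cons (k m z : ℕ) (t Y : List ℕ) :
    hasCliqueTwo k (m + 1) (z :: t) Y =
      (hasCliqueTwo k m (neighbors z t) (neighbors z Y) || hasCliqueTwo k (m + 1) t Y) := rfl

theorem sublist_neighbors {z : ℕ} {l' l : List ℕ} (h : l'.Sublist l)
    (hz : ∀ w ∈ l', crossCode z w = true) : l'.Sublist (neighbors z l) := by
  rw [neighbors_eq_filter, ← List.filter_eq_self.2 hz]
  exact h.filter _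

theorem hasClique_of_sublist {m : ℕ} {l l' : List ℕ} (h : l'.Sublist l)
    (hp : l'.Pairwise fun z w => crossCode z w = true) (hm : m ≤ l'.length) :
    hasClique m l = true := by
  induction m generalizing l l' with
  | zero => rfl
  | succ m ih =>
    induction h with
    | slnil => simp at hm
    | cons z h ih' => rw [hasClique_succ_cons, ih' hp hm, Bool.or_true]
    | cons_cons z h ih' =>
      rw [List.pairwise_cons] at hp
      rw [hasClique_succ_cons, ih (sublist_neighbors h hp.1) hp.2 (by simpa using hm),
        Bool.true_or]

theorem hasCliqueTwo_of_sublist {k m : ℕ} {C Y l₁ l₂ : List ℕ} (h₁ : l₁.Sublist C)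
    (h₂ : l₂.Sublist Y) (hp : (l₁ ++ l₂).Pairwise fun z w => crossCode z w = true)
    (hm : m ≤ l₁.length) (hk : m + k ≤ l₁.length + l₂.length) :
    hasCliqueTwo k m C Y = true := by
  induction m generalizing C Y l₁ l₂ with
  | zero => exact hasClique_of_sublist (h₁.append h₂) hp (by simpa using hk)
  | succ m ih =>
    induction h₁ with
    | slnil => simp at hm
    | cons z h ih' => rw [hasCliqueTwo_succ_cons, ih' hp hm hk, Bool.or_true]
    | cons_cons z h ih' =>
      rw [List.cons_append, List.pairwise_cons] at hp
      rw [hasCliqueTwo_succ_cons, ih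
        (sublist_neighbors h fun w hw => hp.1 w (List.mem_append_left _ hw))
        (sublist_neighbors h₂ fun w hw => hp.1 w (List.mem_append_right _ hw)) hp.2
        (by simpa using hm) (by simp only [List.length_cons] at hk; omega), Bool.true_or]

/-- The pairs `a < b` of numbers below nine with `lo ≤ a`. -/
def pairsFrom (lo : ℕ) : List (ℕ × ℕ) :=
  (List.range 9).flatMap fun b => ((List.range b).filter (lo ≤ ·)).map fun a => (a, b)

/-- Whether the sets with the members `p.1, p.2` and `q.1, q.2` are disjoint. -/
def pairsDisjoint (p q : ℕ × ℕ) : Bool :=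
  p.1 != q.1 && p.1 != q.2 && p.2 != q.1 && p.2 != q.2

/-- The codes of the pairs of two-element sets that avoid the point `0`. -/
def awayCodes : List ℕ :=
  (pairsFrom 1).flatMap fun p => ((pairsFrom 1).filter (pairsDisjoint p)).map fun q =>
    setPairCode p.1 p.2 q.1 q.2

/-- The codes of the pairs of two-element sets whose second set contains the point `0`. -/
def highCodes : List ℕ :=
  (pairsFrom 1).flatMap fun p =>
    ((pairsFrom 0).filter fun q => q.1 == 0 && pairsDisjoint p q).map fun q =>
      setPairCode p.1 p.2 q.1 q.2

theorem mem_pairsFrom {lo a b : ℕ} : (a, b) ∈ pairsFrom lo ↔ lo ≤ a ∧ a < b ∧ b < 9 := by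
  simp only [pairsFrom, List.mem_flatMap, List.mem_range, List.mem_map, List.mem_filter,
    decide_eq_true_eq, Prod.mk.injEq]
  constructor
  · rintro ⟨b, hb, a, ⟨hab, ha⟩, rfl, rfl⟩
    exact ⟨ha, hab, hb⟩
  · rintro ⟨ha, hab, hb⟩
    exact ⟨b, hb, a, ⟨hab, ha⟩, rfl, rfl⟩

theorem crossCode_self_of_mem {z : ℕ} (hz : z ∈ awayCodes ++ highCodes) :
    crossCode z z = false := by
  have : (awayCodes ++ highCodes).all (fun z => !crossCode z z) = true := by decide +kernel
  simpa using List.all_eq_true.1 this z hz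

theorem crossCode_eq_true_of_testBit {z w i : ℕ} (hz : z.testBit (9 + i) = true)
    (hw : w.testBit i = true) : crossCode z w = true := by
  have h : (Nat.land (Nat.shiftRight z 9) w) ≠ 0 := by
    intro h0
    have h1 : ((z >>> 9) &&& w).testBit i = false := by
      change (Nat.land (Nat.shiftRight z 9) w).testBit i = false
      rw [h0, Nat.zero_testBit]
    rw [Nat.testBit_and, Nat.testBit_shiftRight, hz, hw] at h1
    exact absurd h1 (by decide)
  rw [crossCode, Bool.not_eq_true', ← Bool.not_eq_true]
  exact fun hb => h (Nat.eq_of_beq_eq_true hb)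

/-- `z` is the code of the pair `(s, t)`, for some order of the members of `s` and `t`. -/
def IsCode (s t : Finset ℕ) (z : ℕ) : Prop :=
  ∃ a b c d, s = {a, b} ∧ t = {c, d} ∧ z = setPairCode a b c d

theorem IsCode.crossCode {s t s' t' : Finset ℕ} {z z' : ℕ} (h : IsCode s t z)
    (h' : IsCode s' t' z') (hc : ¬Disjoint s t' ∨ ¬Disjoint s' t) : crossCode z z' = true := by
  obtain ⟨a, b, c, d, rfl, rfl, rfl⟩ := h
  obtain ⟨a', b', c', d', rfl, rfl, rfl⟩ := h'
  rcases hc with hc | hc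
  · obtain ⟨p, hp, hp'⟩ := Finset.not_disjoint_iff.1 hc
    apply crossCode_eq_true_of_testBit (i := p + 9)
    · rw [show 9 + (p + 9) = p + 18 by omega]
      rcases Finset.mem_insert.1 hp with rfl | hp
      · simp [setPairCode]
      · rw [Finset.mem_singleton.1 hp]
        simp [setPairCode]
    · rcases Finset.mem_insert.1 hp' with rfl | hp'
      · simp [setPairCode]
      · rw [Finset.mem_singleton.1 hp']
        simp [setPairCode]
  · obtain ⟨p, hp', hp⟩ := Finset.not_disjoint_iff.1 hc
    apply crossCode_eq_true_of_testBit (i := p)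
    · rw [Nat.add_comm]
      rcases Finset.mem_insert.1 hp with rfl | hp
      · simp [setPairCode]
      · rw [Finset.mem_singleton.1 hp]
        simp [setPairCode]
    · rcases Finset.mem_insert.1 hp' with rfl | hp'
      · simp [setPairCode]
      · rw [Finset.mem_singleton.1 hp']
        simp [setPairCode]

theorem exists_pair_of_card_eq_two {s : Finset ℕ} (h : s.card = 2) :
    ∃ a b, a < b ∧ s = {a, b} := by
  obtain ⟨a, b, hab, rfl⟩ := Finset.card_eq_two.1 h
  rcases lt_or_gt_of_ne hab with h | h
  · exact ⟨a, b, h, rfl⟩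
  · exact ⟨b, a, h, Finset.pair_comm a b⟩

/-- A pair whose first set avoids `0` has a code in one of the two lists. -/
theorem exists_isCode_mem {s t : Finset ℕ} (hs : s.card = 2) (ht : t.card = 2)
    (hs9 : ∀ p ∈ s, p < 9) (ht9 : ∀ p ∈ t, p < 9) (hst : Disjoint s t) (h0 : 0 ∉ s) :
    ∃ z, IsCode s t z ∧ (0 ∉ t → z ∈ awayCodes) ∧ (0 ∈ t → z ∈ highCodes) := by
  obtain ⟨a, b, hab, rfl⟩ := exists_pair_of_card_eq_two hs
  obtain ⟨c, d, hcd, rfl⟩ := exists_pair_of_card_eq_two ht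
  have hd : pairsDisjoint (a, b) (c, d) = true := by
    simp only [Finset.disjoint_insert_left, Finset.disjoint_singleton_left, Finset.mem_insert,
      Finset.mem_singleton, not_or] at hst
    simp [pairsDisjoint, hst]
  have ha : 0 < a := Nat.pos_of_ne_zero fun e => h0 (by simp [e])
  have hb9 : b < 9 := hs9 b (by simp)
  have hd9 : d < 9 := ht9 d (by simp)
  refine ⟨setPairCode a b c d, ⟨a, b, c, d, rfl, rfl, rfl⟩, fun h => ?_, fun h => ?_⟩
  · have hc : 0 < c := Nat.pos_of_ne_zero fun e => h (by simp [e])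
    exact List.mem_flatMap.2 ⟨(a, b), mem_pairsFrom.2 ⟨ha, hab, hb9⟩, List.mem_map.2
      ⟨(c, d), List.mem_filter.2 ⟨mem_pairsFrom.2 ⟨hc, hcd, hd9⟩, hd⟩, rfl⟩⟩
  · have hc : c = 0 := by
      simp only [Finset.mem_insert, Finset.mem_singleton] at h
      omega
    exact List.mem_flatMap.2 ⟨(a, b), mem_pairsFrom.2 ⟨ha, hab, hb9⟩, List.mem_map.2
      ⟨(c, d), List.mem_filter.2 ⟨mem_pairsFrom.2 ⟨Nat.zero_le c, hcd, hd9⟩, by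
        simp [hc, hc ▸ hd]⟩, rfl⟩⟩

/-! ### Relabelling the points -/

/-- A list is a restricted growth list with respect to the numbers below `c` if each of its entries
is below `c`, or occurs earlier in the list, or is the least number not yet used. -/
def IsRestrictedGrowth : ℕ → List ℕ → Prop
  | _, [] => True
  | c, x :: l => x ≤ c ∧ IsRestrictedGrowth (max c (x + 1)) l

/-- Numbers below nine can be renamed, with the numbers below `c` kept, so that a given list becomes
a restricted growth list. -/
theorem exists_perm_isRestrictedGrowth (l : List ℕ) (hl : ∀ x ∈ l, x < 9) (c : ℕ) :
    ∃ σ : Equiv.Perm ℕ, (∀ x, x < 9 → σ x < 9) ∧ (∀ x, x < c → σ x = x) ∧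
      IsRestrictedGrowth c (l.map σ) := by
  induction hn : l.length generalizing l c with
  | zero =>
    rw [List.length_eq_zero_iff] at hn
    subst hn
    exact ⟨1, fun x hx => hx, fun x _ => rfl, trivial⟩
  | succ n ih =>
    obtain ⟨x, l, rfl⟩ := List.exists_cons_of_length_eq_add_one hn
    have hn' : l.length = n := by simpa using hn
    have hx9 : x < 9 := hl x (by simp)
    have hl9 : ∀ y ∈ l, y < 9 := fun y hy => hl y (by simp [hy])
    by_cases hx : x < c
    · obtain ⟨σ, h9, hc, hg⟩ := ih l hl9 c hn'
      refine ⟨σ, h9, hc, ?_⟩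
      rw [List.map_cons, hc x hx]
      exact ⟨hx.le, by rwa [max_eq_left (by omega)]⟩
    · have hτ9 : ∀ y, y < 9 → Equiv.swap x c y < 9 := fun y hy => by
        rw [Equiv.swap_apply_def]
        split_ifs <;> omega
      obtain ⟨σ, h9, hc, hg⟩ := ih (l.map (Equiv.swap x c)) (by
        intro y hy
        obtain ⟨z, hz, rfl⟩ := List.mem_map.1 hy
        exact hτ9 z (hl9 z hz)) (c + 1) (by simpa using hn')
      refine ⟨(Equiv.swap x c).trans σ, fun y hy => h9 _ (hτ9 y hy), fun y hy => ?_, ?_⟩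
      · rw [Equiv.trans_apply, Equiv.swap_apply_of_ne_of_ne (by omega) (by omega),
          hc y (by omega)]
      · have hxc : ((Equiv.swap x c).trans σ) x = c := by
          rw [Equiv.trans_apply, Equiv.swap_apply_left, hc c (by omega)]
        rw [List.map_cons, hxc]
        refine ⟨le_rfl, ?_⟩
        rw [max_eq_right (by omega)]
        rw [List.map_map] at hg
        exact hg

theorem IsRestrictedGrowth.eq_range' {c : ℕ} {l : List ℕ} (h : IsRestrictedGrowth c l)
    (hl : l.Nodup) (hc : ∀ x ∈ l, c ≤ x) : l = List.range' c l.length := by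
  induction l generalizing c with
  | nil => rfl
  | cons x l ih =>
    have hx : x = c := le_antisymm h.1 (hc x (by simp))
    subst hx
    rw [List.nodup_cons] at hl
    have h2 := h.2
    rw [max_eq_right (by omega)] at h2
    rw [List.length_cons, List.range'_succ, ← ih h2 hl.2 fun y hy => ?_]
    have hne : y ≠ x := fun e => hl.1 (e ▸ hy)
    have := hc y (by simp [hy])
    omega

theorem IsRestrictedGrowth.swap_last {c u v : ℕ} {w : List ℕ}
    (h : IsRestrictedGrowth c (w ++ [u, v])) (hvu : v < u) :
    IsRestrictedGrowth c (w ++ [v, u]) := by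
  induction w generalizing c with
  | nil =>
    simp only [List.nil_append, IsRestrictedGrowth, and_true] at h ⊢
    omega
  | cons x w ih => exact ⟨h.1, ih h.2⟩

/-- Whether `test` holds for all lists `w ++ w'` with all prefixes longer than `w` satisfying `P`,
where `w'` has length `r`, entries below nine, and restricted growth with respect to `c`. -/
def forallGrowth (P test : List ℕ → Bool) : ℕ → ℕ → List ℕ → Bool
  | 0, _, w => test w
  | r + 1, c, w => (List.range (min (c + 1) 9)).all fun s =>
      !P (w ++ [s]) || forallGrowth P test r (max c (s + 1)) (w ++ [s])

theorem forallGrowth_spec {P test : List ℕ → Bool} {r c : ℕ} {w : List ℕ}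
    (h : forallGrowth P test r c w = true) {w' : List ℕ} (hr : w'.length = r)
    (hw : IsRestrictedGrowth c w') (hw9 : ∀ x ∈ w', x < 9)
    (hP : ∀ v, v <+: w ++ w' → P v = true) : test (w ++ w') = true := by
  induction w' generalizing r c w with
  | nil =>
    subst hr
    rw [List.append_nil]
    exact h
  | cons s w' ih =>
    subst hr
    rw [List.length_cons, forallGrowth, List.all_eq_true] at h
    have hs := hw9 s (by simp)
    have h1 := h s (List.mem_range.2 (by have := hw.1; omega))
    have hv : w ++ s :: w' = (w ++ [s]) ++ w' := by simp
    rw [hv] at hP ⊢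
    rw [hP _ (List.prefix_append _ _)] at h1
    exact ih (by simpa using h1) rfl hw.2 (fun x hx => hw9 x (by simp [hx])) hP

/-! ### Enumerating the pairs through a common point -/

/-- The codes of the pairs `({0, i}, {t₁, s₁}), ({0, i + 1}, {t₂, s₂}), …` for the list
`[t₁, s₁, t₂, s₂, …]`; a last unpaired entry is ignored. -/
def starCodes : ℕ → List ℕ → List ℕ
  | i, t :: s :: w => setPairCode 0 i t s :: starCodes (i + 1) w
  | _, _ => []

/-- Whether `w` can be an initial part of a list `[t₁, s₁, …, tₖ, sₖ]` such that the pairs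
`({0, i}, {tᵢ, sᵢ})` are pairwise in conflict and `tᵢ = i + 1` for each `i`, except that `tₖ < sₖ`
suffices for `i = k`. -/
def starPrefix (k : ℕ) : ℕ → List ℕ → Bool
  | i, t :: s :: w => (i == k && decide (t < s) || t == i + 1) && t != 0 && s != 0 &&
      t != i && s != i && s != t && (starCodes (i + 1) w).all (crossCode (setPairCode 0 i t s)) &&
      starPrefix k (i + 1) w
  | i, [t] => i == k || t == i + 1
  | _, [] => true

theorem mem_starCodes_append {z i : ℕ} {w w' : List ℕ} (h : z ∈ starCodes i w) :
    z ∈ starCodes i (w ++ w') := by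
  induction i, w using starCodes.induct with
  | case1 i t s w ih =>
    rw [starCodes, List.mem_cons] at h
    rw [List.cons_append, List.cons_append, starCodes, List.mem_cons]
    exact h.imp_right ih
  | case2 i w hw =>
    rw [starCodes.eq_2 _ _ hw] at h
    simp at h

theorem starPrefix_of_append {k i : ℕ} {w w' : List ℕ} (h : starPrefix k i (w ++ w') = true) :
    starPrefix k i w = true := by
  induction i, w using starPrefix.induct with
  | case1 i t s w ih =>
    rw [List.cons_append, List.cons_append, starPrefix] at h
    rw [starPrefix]
    simp only [Bool.and_eq_true, List.all_eq_true] at h ⊢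
    exact ⟨⟨h.1.1, fun z hz => h.1.2 z (mem_starCodes_append hz)⟩, ih h.2⟩
  | case2 i t =>
    cases w' with
    | nil => exact h
    | cons s w' =>
      rw [List.cons_append, List.nil_append, starPrefix] at h
      rw [starPrefix]
      simp only [Bool.and_eq_true, Bool.or_eq_true] at h ⊢
      exact h.1.1.1.1.1.1.1.imp_left And.left
  | case3 i => rfl

/-- For `k ≤ 5`, whether there is no way to add `11 - k` pairs of two-element sets of numbers below
nine to the `k` pairs given by `w` so that all eleven are pairwise in conflict, no further first set
contains `0` and at most `k` second sets do. -/
def starMaximal (k : ℕ) (w : List ℕ) : Bool :=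
  !hasCliqueTwo k (11 - 2 * k) ((starCodes 1 w).foldr neighbors awayCodes) highCodes

theorem forallGrowth_starMaximal_three :
    forallGrowth (starPrefix 3 1) (starMaximal 3) 6 4 [] = true := by decide +kernel

theorem forallGrowth_starMaximal_four :
    forallGrowth (starPrefix 4 1) (starMaximal 4) 8 5 [] = true := by decide +kernel

theorem forallGrowth_starMaximal_five :
    forallGrowth (starPrefix 5 1) (starMaximal 5) 10 6 [] = true := by decide +kernel

theorem forallGrowth_six_false :
    forallGrowth (starPrefix 6 1) (fun _ => false) 12 7 [] = true := by decide +kernel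

theorem foldr_neighbors (g l : List ℕ) :
    g.foldr neighbors l = l.filter fun w => g.all fun z => crossCode z w := by
  induction g with
  | nil => simp
  | cons z g ih =>
    rw [List.foldr_cons, neighbors_eq_filter, ih, List.filter_filter]
    simp

/-- A relation comparing any two members of a duplicate-free list has a Hamiltonian path through
them; insertion sort finds one without transitivity. -/
theorem exists_perm_isChain {κ : Type*} (r : κ → κ → Prop) (l : List κ) (hn : l.Nodup)
    (h : ∀ x ∈ l, ∀ y ∈ l, x ≠ y → r x y ∨ r y x) : ∃ l' : List κ, l'.Perm l ∧ l'.IsChain r := by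
  classical
  have key : ∀ (x : κ) (l : List κ), (∀ y ∈ l, r x y ∨ r y x) → l.IsChain r →
      (l.orderedInsert r x).IsChain r ∧
        ∀ b, r b x → (b :: l).IsChain r → (b :: l.orderedInsert r x).IsChain r := by
    intro x l
    induction l with
    | nil =>
      intro _ _
      exact ⟨by simp, fun b hb _ => by simpa using hb⟩
    | cons c l ih =>
      intro hl hc
      have ih' := ih (fun y hy => hl y (by simp [hy])) hc.of_cons
      rw [List.orderedInsert]
      split_ifs with hxc
      · exact ⟨List.isChain_cons_cons.2 ⟨hxc, hc⟩, fun b hb _ =>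
          List.isChain_cons_cons.2 ⟨hb, List.isChain_cons_cons.2 ⟨hxc, hc⟩⟩⟩
      · have hcx : r c x := (hl c (by simp)).resolve_left hxc
        have h2 := ih'.2 c hcx hc
        exact ⟨h2, fun b _ hbc =>
          List.isChain_cons_cons.2 ⟨(List.isChain_cons_cons.1 hbc).1, h2⟩⟩
  refine ⟨l.insertionSort r, List.perm_insertionSort r l, ?_⟩
  induction l with
  | nil => simp
  | cons x l ih =>
    rw [List.nodup_cons] at hn
    have ih' := ih hn.2 fun y hy z hz => h y (by simp [hy]) z (by simp [hz])
    refine (key x _ (fun y hy => ?_) ih').1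
    have hy' : y ∈ l := (List.perm_insertionSort r l).mem_iff.1 hy
    exact h x (by simp) y (by simp [hy']) fun e => hn.1 (e ▸ hy')

theorem starCodes_flatMap {κ : Type*} (b t s : κ → ℕ) (xs : List κ) (i : ℕ)
    (hb : xs.map b = List.range' i xs.length) :
    starCodes i (xs.flatMap fun x => [t x, s x]) =
      xs.map fun x => setPairCode 0 (b x) (t x) (s x) := by
  induction xs generalizing i with
  | nil => rfl
  | cons x xs ih =>
    rw [List.map_cons, List.length_cons, List.range'_succ, List.cons.injEq] at hb
    rw [List.flatMap_cons, List.map_cons, ← ih (i + 1) hb.2, hb.1]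
    rfl

theorem starPrefix_flatMap {κ : Type*} {k : ℕ} {b t s : κ → ℕ} {xs : List κ} {i : ℕ}
    (hb : xs.map b = List.range' i xs.length)
    (hts : ∀ x ∈ xs, (b x = k ∧ t x < s x ∨ t x = b x + 1) ∧ t x ≠ 0 ∧ s x ≠ 0 ∧ t x ≠ b x ∧
      s x ≠ b x ∧ s x ≠ t x)
    (hp : xs.Pairwise fun x y => crossCode (setPairCode 0 (b x) (t x) (s x))
      (setPairCode 0 (b y) (t y) (s y)) = true) :
    starPrefix k i (xs.flatMap fun x => [t x, s x]) = true := by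
  induction xs generalizing i with
  | nil => rfl
  | cons x xs ih =>
    rw [List.map_cons, List.length_cons, List.range'_succ, List.cons.injEq] at hb
    rw [List.pairwise_cons] at hp
    have h1 := ih hb.2 (fun y hy => hts y (by simp [hy])) hp.2
    obtain ⟨hx1, hx2, hx3, hx4, hx5, hx6⟩ := hts x (by simp)
    rw [hb.1] at hx1 hx4 hx5 hp
    rw [List.flatMap_cons, List.cons_append, List.cons_append, List.nil_append, starPrefix]
    simp only [Bool.and_eq_true, Bool.or_eq_true, beq_iff_eq, bne_iff_ne, decide_eq_true_eq,
      List.all_eq_true]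
    refine ⟨⟨⟨⟨⟨⟨⟨hx1, hx2⟩, hx3⟩, hx4⟩, hx5⟩, hx6⟩, fun z hz => ?_⟩, h1⟩
    rw [starCodes_flatMap b t s xs (i + 1) hb.2] at hz
    obtain ⟨y, hy, rfl⟩ := List.mem_map.1 hz
    exact hp.1 y hy

/-- Two pairs whose first sets share a point are in conflict at one of the other two points of
their first sets. -/
theorem WeaklyCross.mem_or_mem {κ α : Type*} [DecidableEq α] {L H : κ → Finset α}
    (h : WeaklyCross L H) {x y : κ} (hxy : x ≠ y) {p a b : α} (hx : L x = {p, a})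
    (hy : L y = {p, b}) : a ∈ H y ∨ b ∈ H x := by
  have hpx : p ∉ H x := Finset.disjoint_left.1 (h.disjoint x) (by simp [hx])
  have hpy : p ∉ H y := Finset.disjoint_left.1 (h.disjoint y) (by simp [hy])
  refine (h.cross x y hxy).imp (fun hd => ?_) fun hd => ?_
  · obtain ⟨q, hq, hq'⟩ := Finset.not_disjoint_iff.1 hd
    rw [hx, Finset.mem_insert, Finset.mem_singleton] at hq
    rcases hq with rfl | rfl
    · exact absurd hq' hpy
    · exact hq'
  · obtain ⟨q, hq, hq'⟩ := Finset.not_disjoint_iff.1 hd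
    rw [hy, Finset.mem_insert, Finset.mem_singleton] at hq
    rcases hq with rfl | rfl
    · exact absurd hq' hpx
    · exact hq'

/-- The pairs whose first sets contain `p`, ordered along a Hamiltonian path, can be relabelled so
that they are encoded by one of the lists enumerated by `forallGrowth`. -/
theorem NinePointSystem.exists_star {κ : Type*} {L H : κ → Finset ℕ}
    (h : NinePointSystem L H) {p : ℕ} (xs : List κ) (hn : xs.Nodup) (hne : xs ≠ [])
    (hp : ∀ x ∈ xs, p ∈ L x) :
    ∃ (L' H' : κ → Finset ℕ) (w : List ℕ), NinePointSystem L' H' ∧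
      (∀ x, 0 ∈ L' x ↔ p ∈ L x) ∧ (∀ x, 0 ∈ H' x ↔ p ∈ H x) ∧
      w.length = 2 * xs.length ∧ IsRestrictedGrowth (xs.length + 1) w ∧ (∀ q ∈ w, q < 9) ∧
      starPrefix xs.length 1 w = true ∧
      ∀ z ∈ starCodes 1 w, ∃ x ∈ xs, IsCode (L' x) (H' x) z := by
  classical
  have ha : ∀ x, ∃ a, x ∈ xs → a ≠ p ∧ L x = {p, a} := by
    intro x
    by_cases hx : x ∈ xs
    · obtain ⟨u, v, huv, hL⟩ := Finset.card_eq_two.1 (h.card_left x)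
      have hpx := hp x hx
      rw [hL, Finset.mem_insert, Finset.mem_singleton] at hpx
      rcases hpx with rfl | rfl
      · exact ⟨v, fun _ => ⟨huv.symm, hL⟩⟩
      · exact ⟨u, fun _ => ⟨huv, hL.trans (Finset.pair_comm u _)⟩⟩
    · exact ⟨0, fun hx' => absurd hx' hx⟩
  choose a ha using ha
  -- Order the pairs along a Hamiltonian path of the tournament of their conflicts.
  obtain ⟨ys, hperm, hchain⟩ := exists_perm_isChain (fun x y => a y ∈ H x) xs hn
    fun x hx y hy hxy => (h.mem_or_mem hxy (ha x hx).2 (ha y hy).2).symm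
  have hlen : ys.length = xs.length := hperm.length_eq
  have hyn : ys.Nodup := hperm.nodup_iff.2 hn
  have hys : ∀ x, x ∈ ys ↔ x ∈ xs := fun x => hperm.mem_iff
  rw [← hlen]
  have haL : ∀ x ∈ ys, a x ∈ L x := fun x hx => by
    rw [(ha x ((hys x).1 hx)).2]
    simp
  have hainj : (ys.map a).Nodup := by
    refine List.Nodup.map_on (fun x hx y hy hxy => ?_) hyn
    by_contra hne
    rcases h.mem_or_mem hne (ha x ((hys x).1 hx)).2 (ha y ((hys y).1 hy)).2 with h1 | h1
    · exact Finset.disjoint_left.1 (h.disjoint y) (haL y hy) (hxy ▸ h1)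
    · exact Finset.disjoint_left.1 (h.disjoint x) (haL x hx) (hxy ▸ h1)
  have hp9 : p < 9 := by
    obtain ⟨x, hx⟩ := List.exists_mem_of_ne_nil xs hne
    exact h.left_lt x p (hp x hx)
  -- Rename the common point to `0` and the second points of the first sets to `1, 2, …`.
  obtain ⟨σ, hσ9, -, hσ⟩ := exists_perm_isRestrictedGrowth (p :: ys.map a) (by
    intro q hq
    rcases List.mem_cons.1 hq with rfl | hq
    · exact hp9
    · obtain ⟨x, hx, rfl⟩ := List.mem_map.1 hq
      exact h.left_lt x _ (haL x hx)) 0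
  have hσ' := hσ.eq_range' (by
    refine List.Nodup.map σ.injective (List.nodup_cons.2 ⟨fun hpa => ?_, hainj⟩)
    obtain ⟨x, hx, hxp⟩ := List.mem_map.1 hpa
    exact (ha x ((hys x).1 hx)).1 hxp) (fun _ _ => Nat.zero_le _)
  simp only [List.map_cons, List.map_map, List.length_cons, List.length_map, List.range'_succ,
    List.cons.injEq, Nat.zero_add] at hσ'
  obtain ⟨hσp, hσb⟩ := hσ'
  set b : κ → ℕ := σ ∘ a with hbdef
  have h1 := h.perm σ hσ9
  set k := ys.length with hk
  have hL1 : ∀ x ∈ ys, (L x).image σ = {0, b x} := fun x hx => by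
    rw [(ha x ((hys x).1 hx)).2, Finset.image_insert, Finset.image_singleton, hσp, hbdef,
      Function.comp_apply]
  have hbk : ∀ x ∈ ys, 1 ≤ b x ∧ b x ≤ k := fun x hx => by
    have : b x ∈ ys.map b := List.mem_map_of_mem hx
    rw [hσb, List.mem_range'_1] at this
    omega
  have hbget : ∀ i (hi : i < ys.length), b ys[i] = i + 1 := fun i hi => by
    have h2 : (ys.map b)[i]'(by simpa using hi) = i + 1 := by
      simp only [hσb, List.getElem_range']
      omega
    simpa using h2
  have hts : ∀ x, ∃ t s, x ∈ ys → (H x).image σ = {t, s} ∧ t ≠ s ∧ (b x < k → t = b x + 1) := by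
    intro x
    by_cases hx : x ∈ ys
    · obtain ⟨u, v, huv, hH⟩ := Finset.card_eq_two.1 (h1.card_right x)
      obtain ⟨i, hi, rfl⟩ := List.getElem_of_mem hx
      by_cases hik : i + 1 < ys.length
      · have hmem : i + 2 ∈ (H ys[i]).image σ := by
          refine Finset.mem_image.2 ⟨a ys[i + 1], List.isChain_iff_getElem.1 hchain i hik, ?_⟩
          exact hbget (i + 1) hik
        rw [hH, Finset.mem_insert, Finset.mem_singleton] at hmem
        rcases hmem with rfl | rfl
        · exact ⟨_, v, fun _ => ⟨hH, huv, fun _ => by rw [hbget i hi]⟩⟩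
        · exact ⟨_, u, fun _ => ⟨hH.trans (Finset.pair_comm _ _), huv.symm,
            fun _ => by rw [hbget i hi]⟩⟩
      · refine ⟨u, v, fun _ => ⟨hH, huv, fun hlt => ?_⟩⟩
        rw [hbget i hi] at hlt
        omega
    · exact ⟨0, 0, fun hx' => absurd hx' hx⟩
  choose t s hts using hts
  -- Rename the remaining points of the second sets.
  obtain ⟨τ, hτ9, hτk, hτ⟩ := exists_perm_isRestrictedGrowth (ys.flatMap fun x => [t x, s x]) (by
    intro q hq
    obtain ⟨x, hx, hq⟩ := List.mem_flatMap.1 hq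
    refine h1.right_lt x q ?_
    rw [(hts x hx).1]
    simpa using hq) (k + 1)
  have h2 := h1.perm τ hτ9
  have hL2 : ∀ x ∈ ys, ((L x).image σ).image τ = {0, b x} := fun x hx => by
    rw [hL1 x hx, Finset.image_insert, Finset.image_singleton, hτk 0 (by omega),
      hτk (b x) (by have := (hbk x hx).2; omega)]
  -- The two points of the last second set can be listed in either order.
  have hfin : ∃ t' s' : κ → ℕ, (∀ x ∈ ys, ((H x).image σ).image τ = {t' x, s' x} ∧
      t' x ≠ s' x ∧ (b x = k ∧ t' x < s' x ∨ t' x = b x + 1)) ∧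
      IsRestrictedGrowth (k + 1) (ys.flatMap fun x => [t' x, s' x]) := by
    have hy0 : ys ≠ [] := fun e => hne (by
      rw [e] at hperm
      exact hperm.symm.eq_nil)
    obtain ⟨vs, z, hvs⟩ : ∃ vs z, ys = vs ++ [z] :=
      ⟨ys.dropLast, ys.getLast hy0, (List.dropLast_concat_getLast hy0).symm⟩
    have hH2 : ∀ x ∈ ys, ((H x).image σ).image τ = {τ (t x), τ (s x)} := fun x hx => by
      rw [(hts x hx).1, Finset.image_insert, Finset.image_singleton]
    have hbz : ∀ x ∈ ys, b x = k → x = z := by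
      intro x hx hxk
      obtain ⟨i, hi, rfl⟩ := List.getElem_of_mem hx
      have hik : i = vs.length := by
        rw [hbget i hi] at hxk
        have : k = vs.length + 1 := by rw [hk, hvs]; simp
        omega
      subst hik
      simp [hvs]
    have hτt : ∀ x ∈ ys, x ≠ z → τ (t x) = b x + 1 := fun x hx hxz => by
      have hlt : b x < k := lt_of_le_of_ne (hbk x hx).2 fun e => hxz (hbz x hx e)
      rw [(hts x hx).2.2 hlt, hτk _ (by omega)]
    have hzk : b z = k := by
      have hz : z = ys[vs.length]'(by rw [hvs]; simp) := by simp [hvs]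
      rw [hz, hbget, hk, hvs]
      simp
    have hzy : z ∈ ys := by simp [hvs]
    have hzv : z ∉ vs := by
      rw [hvs, List.nodup_append] at hyn
      exact fun hz => hyn.2.2 z hz z (by simp) rfl
    have hflat : (ys.flatMap fun x => [t x, s x]).map τ =
        (vs.flatMap fun x => [τ (t x), τ (s x)]) ++ [τ (t z), τ (s z)] := by
      rw [hvs, List.flatMap_append, List.map_append, List.map_flatMap]
      simp
    rw [hflat] at hτ
    rcases lt_or_gt_of_ne fun e => (hts z hzy).2.1 (τ.injective e) with hlt | hgt
    · refine ⟨τ ∘ t, τ ∘ s, fun x hx => ⟨hH2 x hx, fun e => (hts x hx).2.1 (τ.injective e), ?_⟩, ?_⟩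
      · by_cases hxz : x = z
        · exact Or.inl (hxz ▸ ⟨hzk, hlt⟩)
        · exact Or.inr (hτt x hx hxz)
      · rw [hvs, List.flatMap_append]
        simpa using hτ
    · refine ⟨fun x => if x = z then τ (s x) else τ (t x),
        fun x => if x = z then τ (t x) else τ (s x), fun x hx => ?_, ?_⟩
      · by_cases hxz : x = z
        · subst hxz
          simp only [if_true]
          exact ⟨(hH2 x hx).trans (Finset.pair_comm _ _),
            fun e => (hts x hx).2.1 (τ.injective e.symm), Or.inl ⟨hzk, hgt⟩⟩
        · simp only [hxz, if_false]
          exact ⟨hH2 x hx, fun e => (hts x hx).2.1 (τ.injective e), Or.inr (hτt x hx hxz)⟩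
      · have hcongr : (vs.flatMap fun x => [if x = z then τ (s x) else τ (t x),
            if x = z then τ (t x) else τ (s x)]) = vs.flatMap fun x => [τ (t x), τ (s x)] := by
          refine List.flatMap_congr fun x hx => ?_
          have hxz : x ≠ z := fun e => hzv (e ▸ hx)
          simp [hxz]
        rw [hvs, List.flatMap_append, hcongr]
        simpa using hτ.swap_last hgt
  obtain ⟨t', s', hts', hgrow⟩ := hfin
  have hcode : ∀ x ∈ ys, IsCode (((L x).image σ).image τ) (((H x).image σ).image τ)
      (setPairCode 0 (b x) (t' x) (s' x)) := fun x hx =>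
    ⟨0, b x, t' x, s' x, hL2 x hx, (hts' x hx).1, rfl⟩
  have hzero : ∀ S : Finset ℕ, 0 ∈ (S.image σ).image τ ↔ p ∈ S := by
    intro S
    have : τ (σ p) = 0 := by rw [hσp, hτk 0 (by omega)]
    rw [← this, τ.injective.mem_finset_image, σ.injective.mem_finset_image]
  refine ⟨_, _, ys.flatMap fun x => [t' x, s' x], h2, fun x => hzero _, fun x => hzero _, ?_, hgrow,
    ?_, ?_, ?_⟩
  · simp [List.length_flatMap, hk, mul_comm]
  · intro q hq
    obtain ⟨x, hx, hq⟩ := List.mem_flatMap.1 hq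
    refine h2.right_lt x q ?_
    rw [(hts' x hx).1]
    simpa using hq
  · refine starPrefix_flatMap hσb (fun x hx => ?_) ?_
    · have hd := h2.disjoint x
      rw [hL2 x hx, (hts' x hx).1] at hd
      simp only [Finset.disjoint_insert_left, Finset.disjoint_singleton_left, Finset.mem_insert,
        Finset.mem_singleton, not_or] at hd
      exact ⟨(hts' x hx).2.2, Ne.symm hd.1.1, Ne.symm hd.1.2, Ne.symm hd.2.1, Ne.symm hd.2.2,
        (hts' x hx).2.1.symm⟩
    · exact List.Pairwise.imp_of_mem (fun {x y} hx hy hxy =>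
        (hcode x hx).crossCode (hcode y hy) (h2.cross x y hxy)) hyn
  · intro z hz
    rw [starCodes_flatMap b t' s' ys 1 hσb] at hz
    obtain ⟨x, hx, rfl⟩ := List.mem_map.1 hz
    exact ⟨x, (hys x).1 hx, hcode x hx⟩

/-! ### At most ten pairs -/

/-- Pairwise conflicting pairs outside the star form a clique that the search would have found. -/
theorem NinePointSystem.starMaximal_eq_false {κ : Type*} [Fintype κ] [DecidableEq κ]
    (hκ : Fintype.card κ = 11) {L H : κ → Finset ℕ} (h : NinePointSystem L H) {w : List ℕ}
    (h5 : (Finset.univ.filter fun x => 0 ∈ L x).card ≤ 5)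
    (hH : (Finset.univ.filter fun x => 0 ∈ H x).card ≤ (Finset.univ.filter fun x => 0 ∈ L x).card)
    (hw : ∀ z ∈ starCodes 1 w, ∃ x, 0 ∈ L x ∧ IsCode (L x) (H x) z) :
    starMaximal (Finset.univ.filter fun x => 0 ∈ L x).card w = false := by
  set k := (Finset.univ.filter fun x => 0 ∈ L x).card
  have hcode : ∀ x, ∃ z, 0 ∉ L x → IsCode (L x) (H x) z ∧ (0 ∉ H x → z ∈ awayCodes) ∧
      (0 ∈ H x → z ∈ highCodes) := fun x => by
    by_cases h0 : 0 ∈ L x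
    · exact ⟨0, fun h0' => absurd h0 h0'⟩
    · obtain ⟨z, hz⟩ := exists_isCode_mem (h.card_left x) (h.card_right x) (h.left_lt x)
        (h.right_lt x) (h.disjoint x) h0
      exact ⟨z, fun _ => hz⟩
  choose e he using hcode
  have hcross : ∀ x y, x ≠ y → 0 ∉ L x → 0 ∉ L y → crossCode (e x) (e y) = true :=
    fun x y hxy hx hy => (he x hx).1.crossCode (he y hy).1 (h.cross x y hxy)
  have hinj : ∀ x y, 0 ∉ L x → 0 ∉ L y → e x = e y → x = y := by
    intro x y hx hy hxy
    by_contra hne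
    have h1 := hcross x y hne hx hy
    have hmem : e y ∈ awayCodes ++ highCodes := by
      by_cases h0 : 0 ∈ H y
      · exact List.mem_append_right _ ((he y hy).2.2 h0)
      · exact List.mem_append_left _ ((he y hy).2.1 h0)
    rw [hxy, crossCode_self_of_mem hmem] at h1
    exact Bool.false_ne_true h1
  have hgstar : ∀ x, 0 ∉ L x → ∀ z ∈ starCodes 1 w, crossCode z (e x) = true := by
    intro x hx z hz
    obtain ⟨y, hy, hyz⟩ := hw z hz
    exact hyz.crossCode (he x hx).1 (h.cross y x fun e => hx (e ▸ hy))
  -- The codes of a set of pairs form a duplicate-free sublist of any list containing them.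
  have hsub : ∀ (s : Finset κ) (l : List ℕ), (∀ x ∈ s, 0 ∉ L x) → (∀ x ∈ s, e x ∈ l) →
      ∃ l' : List ℕ, l'.Sublist l ∧ l'.Nodup ∧ l'.length = s.card ∧ ∀ z, z ∈ l' ↔ z ∈ s.image e := by
    intro s l hs hl
    have hmem : ∀ z, z ∈ (l.filter (· ∈ s.image e)).dedup ↔ z ∈ s.image e := by
      intro z
      rw [List.mem_dedup, List.mem_filter, decide_eq_true_eq]
      refine ⟨And.right, fun hz => ⟨?_, hz⟩⟩
      obtain ⟨x, hx, rfl⟩ := Finset.mem_image.1 hz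
      exact hl x hx
    refine ⟨_, (List.dedup_sublist _).trans List.filter_sublist, List.nodup_dedup _, ?_, hmem⟩
    rw [← List.toFinset_card_of_nodup (List.nodup_dedup _), ← Finset.card_image_of_injOn
      (f := e) (s := s) fun x hx y hy => hinj x y (hs x hx) (hs y hy)]
    congr 1
    ext z
    rw [List.mem_toFinset, hmem]
  let N := Finset.univ.filter fun x => 0 ∉ L x ∧ 0 ∉ H x
  let M := Finset.univ.filter fun x => 0 ∈ H x
  have hN : ∀ x ∈ N, 0 ∉ L x ∧ 0 ∉ H x := fun x hx => (Finset.mem_filter.1 hx).2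
  have hM : ∀ x ∈ M, 0 ∈ H x := fun x hx => (Finset.mem_filter.1 hx).2
  have hML : ∀ x ∈ M, 0 ∉ L x := fun x hx h0 =>
    Finset.disjoint_left.1 (h.disjoint x) h0 (hM x hx)
  have hcard : 11 ≤ k + M.card + N.card := by
    have : (Finset.univ : Finset κ) ⊆ (Finset.univ.filter fun x => 0 ∈ L x) ∪ M ∪ N := by
      intro x _
      simp only [M, N, Finset.mem_union, Finset.mem_filter, Finset.mem_univ, true_and]
      tauto
    have h1 := Finset.card_le_card this
    rw [Finset.card_univ, hκ] at h1
    refine h1.trans ((Finset.card_union_le _ _).trans ?_)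
    exact Nat.add_le_add_right (Finset.card_union_le _ _) _
  obtain ⟨l₁, hl₁, hn₁, hc₁, hm₁⟩ := hsub N ((starCodes 1 w).foldr neighbors awayCodes)
    (fun x hx => (hN x hx).1) fun x hx => by
      rw [foldr_neighbors, List.mem_filter, List.all_eq_true]
      exact ⟨(he x (hN x hx).1).2.1 (hN x hx).2, hgstar x (hN x hx).1⟩
  obtain ⟨l₂, hl₂, hn₂, hc₂, hm₂⟩ := hsub M highCodes hML fun x hx => (he x (hML x hx)).2.2 (hM x hx)
  have hmem : ∀ z ∈ l₁ ++ l₂, ∃ x, 0 ∉ L x ∧ e x = z := by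
    intro z hz
    rcases List.mem_append.1 hz with hz | hz
    · obtain ⟨x, hx, rfl⟩ := Finset.mem_image.1 ((hm₁ z).1 hz)
      exact ⟨x, (hN x hx).1, rfl⟩
    · obtain ⟨x, hx, rfl⟩ := Finset.mem_image.1 ((hm₂ z).1 hz)
      exact ⟨x, hML x hx, rfl⟩
  have hnodup : (l₁ ++ l₂).Nodup := by
    refine List.nodup_append.2 ⟨hn₁, hn₂, fun z hz z' hz' hzz' => ?_⟩
    subst hzz'
    obtain ⟨x, hx, hxz⟩ := Finset.mem_image.1 ((hm₁ z).1 hz)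
    obtain ⟨y, hy, hyz⟩ := Finset.mem_image.1 ((hm₂ z).1 hz')
    have := hinj x y (hN x hx).1 (hML y hy) (hxz.trans hyz.symm)
    exact (hN x hx).2 (this ▸ hM y hy)
  have hfound := hasCliqueTwo_of_sublist (k := k) (m := 11 - 2 * k) hl₁ hl₂
    (List.Pairwise.imp_of_mem (fun {z z'} hz hz' hne => by
      obtain ⟨x, hx, rfl⟩ := hmem z hz
      obtain ⟨y, hy, rfl⟩ := hmem z' hz'
      exact hcross x y (fun e => hne (by rw [e])) hx hy) hnodup)
    (by rw [hc₁]; have : M.card ≤ k := hH; omega)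
    (by
      rw [hc₁, hc₂]
      omega)
  rw [starMaximal, hfound, Bool.not_true]

/-- If some point lies in at least three first sets and in at most as many second sets, the star of
that point is one of those excluded by the search; with six or more first sets there is no star. -/
theorem NinePointSystem.false_of_three_le {κ : Type*} [Fintype κ] [DecidableEq κ]
    (hκ : Fintype.card κ = 11) {L H : κ → Finset ℕ} (h : NinePointSystem L H) {p : ℕ}
    (h3 : 3 ≤ (Finset.univ.filter fun x => p ∈ L x).card)
    (hH : (Finset.univ.filter fun x => p ∈ H x).card ≤
      (Finset.univ.filter fun x => p ∈ L x).card) : False := by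
  obtain ⟨s, hs, hsc⟩ := Finset.exists_subset_card_eq
    (min_le_left (Finset.univ.filter fun x => p ∈ L x).card 6)
  have hlen : s.toList.length = min (Finset.univ.filter fun x => p ∈ L x).card 6 := by
    rw [Finset.length_toList, hsc]
  obtain ⟨L', H', w, h', hL', hH', hw, hgrow, hw9, hpre, hstar⟩ :=
    h.exists_star (p := p) s.toList s.nodup_toList
      (fun e => by rw [e, List.length_nil] at hlen; omega)
      fun x hx => (Finset.mem_filter.1 (hs (Finset.mem_toList.1 hx))).2
  have hpre' : ∀ k, s.toList.length = k → ∀ v, v <+: [] ++ w → starPrefix k 1 v = true := by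
    rintro k rfl v ⟨v', hv'⟩
    rw [List.nil_append] at hv'
    exact starPrefix_of_append (w' := v') (hv'.symm ▸ hpre)
  simp only [← hL', ← hH'] at h3 hH hlen
  rcases Nat.lt_or_ge (Finset.univ.filter fun x => 0 ∈ L' x).card 6 with h6 | h6
  · rw [min_eq_left h6.le] at hlen
    have hfalse := h'.starMaximal_eq_false hκ (w := w) (by omega) hH fun z hz => by
      obtain ⟨x, hx, hxz⟩ := hstar z hz
      exact ⟨x, (hL' x).2 (Finset.mem_filter.1 (hs (Finset.mem_toList.1 hx))).2, hxz⟩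
    have hk : (Finset.univ.filter fun x => 0 ∈ L' x).card = 3 ∨
        (Finset.univ.filter fun x => 0 ∈ L' x).card = 4 ∨
        (Finset.univ.filter fun x => 0 ∈ L' x).card = 5 := by omega
    rcases hk with hk | hk | hk <;> rw [hk] at hlen hfalse <;> rw [hlen] at hw hgrow
    · have := forallGrowth_spec forallGrowth_starMaximal_three hw hgrow hw9 (hpre' 3 hlen)
      exact Bool.false_ne_true (hfalse.symm.trans this)
    · have := forallGrowth_spec forallGrowth_starMaximal_four hw hgrow hw9 (hpre' 4 hlen)
      exact Bool.false_ne_true (hfalse.symm.trans this)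
    · have := forallGrowth_spec forallGrowth_starMaximal_five hw hgrow hw9 (hpre' 5 hlen)
      exact Bool.false_ne_true (hfalse.symm.trans this)
  · rw [min_eq_right h6] at hlen
    rw [hlen] at hw hgrow
    exact Bool.false_ne_true
      (forallGrowth_spec forallGrowth_six_false hw hgrow hw9 (hpre' 6 hlen))

/-- A weakly cross-intersecting family of pairs of sets with at most two elements has at most ten
members. -/
theorem WeaklyCross.card_le_ten {κ : Type*} [Fintype κ] {L H : κ → Finset ℕ}
    (h : WeaklyCross L H) (hL : ∀ x, (L x).card ≤ 2) (hH : ∀ x, (H x).card ≤ 2) :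
    Fintype.card κ ≤ 10 := by
  classical
  by_contra! hcon
  obtain ⟨s, -, hs⟩ := Finset.exists_subset_card_eq (s := (Finset.univ : Finset κ)) (n := 11)
    (by rwa [Finset.card_univ])
  have hs' : Fintype.card s = 11 := by rw [Fintype.card_coe, hs]
  have h11 : WeaklyCross (fun x : s => L x) (fun x : s => H x) :=
    ⟨fun x => h.disjoint x, fun x y hxy => h.cross x y fun e => hxy (Subtype.ext e)⟩
  obtain ⟨L', H', h'⟩ := h11.exists_ninePointSystem hs' (fun x => hL x) (fun x => hH x)
  obtain ⟨p, hp⟩ := h'.exists_three_le hs'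
  rcases le_total (Finset.univ.filter fun x => p ∈ H' x).card
    (Finset.univ.filter fun x => p ∈ L' x).card with hle | hle
  · exact h'.false_of_three_le hs' (p := p) (by omega) hle
  · exact h'.symm.false_of_three_le hs' (p := p) (by omega) hle

/-! ### Permutation arrays -/

theorem le_chebyshevDist_iff {n : ℕ} (hn : 5 ≤ n) (σ π : Equiv.Perm (Fin n)) :
    n - 2 ≤ chebyshevDist σ π ↔
      ∃ i, (σ i : ℕ) + (n - 2) ≤ π i ∨ (π i : ℕ) + (n - 2) ≤ σ i := by
  rw [chebyshevDist, Finset.le_sup_iff (by simp; omega)]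
  simp only [Finset.mem_univ, true_and]
  refine exists_congr fun i => ?_
  omega

/-- The positions at which a permutation takes one of the values in `s`. -/
def positions {n : ℕ} (s : Finset (Fin n)) (σ : Equiv.Perm (Fin n)) : Finset ℕ :=
  s.image fun v => (σ.symm v : ℕ)

theorem mem_positions {n : ℕ} {s : Finset (Fin n)} {σ : Equiv.Perm (Fin n)} {i : Fin n} :
    (i : ℕ) ∈ positions s σ ↔ σ i ∈ s := by
  rw [positions, Finset.mem_image]
  constructor
  · rintro ⟨v, hv, hvi⟩
    rw [← Fin.ext hvi, Equiv.apply_symm_apply]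
    exact hv
  · exact fun h => ⟨σ i, h, by rw [Equiv.symm_apply_apply]⟩

theorem disjoint_positions {n : ℕ} {s t : Finset (Fin n)} (h : Disjoint s t)
    (σ : Equiv.Perm (Fin n)) : Disjoint (positions s σ) (positions t σ) := by
  rw [Finset.disjoint_left]
  intro a ha ha'
  obtain ⟨v, hv, rfl⟩ := Finset.mem_image.1 ha
  obtain ⟨u, hu, huv⟩ := Finset.mem_image.1 ha'
  have : u = v := σ.symm.injective (Fin.ext huv)
  exact Finset.disjoint_left.1 h hv (this ▸ hu)

theorem IsPermArray.card_le_ten {n : ℕ} (hn : 5 ≤ n) {A : Finset (Equiv.Perm (Fin n))}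
    (hA : IsPermArray n (n - 2) A) : A.card ≤ 10 := by
  rw [isPermArray_iff] at hA
  let lo : Finset (Fin n) := {⟨0, by omega⟩, ⟨1, by omega⟩}
  let hi : Finset (Fin n) := {⟨n - 2, by omega⟩, ⟨n - 1, by omega⟩}
  have hlo : ∀ v : Fin n, (v : ℕ) ≤ 1 → v ∈ lo := fun v hv => by
    simp only [lo, Finset.mem_insert, Finset.mem_singleton, Fin.ext_iff]
    omega
  have hhi : ∀ v : Fin n, n - 2 ≤ (v : ℕ) → v ∈ hi := fun v hv => by
    have := v.2
    simp only [hi, Finset.mem_insert, Finset.mem_singleton, Fin.ext_iff]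
    omega
  have hd : Disjoint lo hi := by
    simp only [lo, hi, Finset.disjoint_insert_left, Finset.disjoint_singleton_left,
      Finset.mem_insert, Finset.mem_singleton, Fin.ext_iff]
    omega
  have h : WeaklyCross (fun σ : A => positions lo σ.1) (fun σ : A => positions hi σ.1) := by
    refine ⟨fun σ => disjoint_positions hd σ.1, fun σ π hσπ => ?_⟩
    obtain ⟨i, hi'⟩ := (le_chebyshevDist_iff hn σ.1 π.1).1
      (hA σ.1 σ.2 π.1 π.2 fun e => hσπ (Subtype.ext e))
    have h1 := (σ.1 i).2
    have h2 := (π.1 i).2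
    rcases hi' with hi' | hi'
    · exact Or.inl (Finset.not_disjoint_iff.2 ⟨i, mem_positions.2 (hlo _ (by omega)),
        mem_positions.2 (hhi _ (by omega))⟩)
    · exact Or.inr (Finset.not_disjoint_iff.2 ⟨i, mem_positions.2 (hlo _ (by omega)),
        mem_positions.2 (hhi _ (by omega))⟩)
  have := h.card_le_ten
    (fun σ => Finset.card_image_le.trans (Finset.card_insert_le _ _))
    (fun σ => Finset.card_image_le.trans (Finset.card_insert_le _ _))
  rwa [Fintype.card_coe] at this

/-- The positions of the values `0, 1, n - 2, n - 1`, in this order, in ten permutations that are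
pairwise at Chebyshev distance at least `n - 2`. -/
def extremePositions : Fin 10 → Fin 4 → Fin 5 :=
  ![![0, 1, 2, 3], ![2, 4, 3, 1], ![2, 0, 3, 4], ![3, 4, 1, 0], ![0, 3, 4, 2],
    ![4, 1, 0, 3], ![4, 0, 2, 1], ![1, 3, 0, 2], ![1, 2, 4, 0], ![3, 2, 1, 4]]

theorem extremePositions_injective (x : Fin 10) : Function.Injective (extremePositions x) := by
  revert x
  decide

/-- The pairs of indices `0, 1, 2, 3` compared here are those of values differing by at least
`n - 2`. -/
theorem extremePositions_cross (x y : Fin 10) (hxy : x ≠ y) :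
    ∃ i j : Fin 4, ((i, j) = (0, 3) ∨ (i, j) = (0, 2) ∨ (i, j) = (1, 3)) ∧
      (extremePositions x i = extremePositions y j ∨
        extremePositions y i = extremePositions x j) := by
  revert x y
  decide

theorem exists_isPermArray_card_eq_ten {n : ℕ} (hn : 5 ≤ n) :
    ∃ A : Finset (Equiv.Perm (Fin n)), IsPermArray n (n - 2) A ∧ A.card = 10 := by
  let val : Fin 4 → Fin n :=
    ![⟨0, by omega⟩, ⟨1, by omega⟩, ⟨n - 2, by omega⟩, ⟨n - 1, by omega⟩]
  have hval : Function.Injective val := by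
    intro i j hij
    fin_cases i <;> fin_cases j <;> simp [val, Fin.ext_iff] at hij ⊢ <;> omega
  have hext : ∀ x, ∃ σ : Equiv.Perm (Fin n),
      ∀ i, σ (Fin.castLE hn (extremePositions x i)) = val i := fun x => by
    obtain ⟨σ, hσ⟩ := Equiv.Perm.exists_extending_pair
      (fun i => Fin.castLE hn (extremePositions x i)) val
      ((Fin.castLE_injective hn).comp (extremePositions_injective x)) hval
    exact ⟨σ, hσ⟩
  choose σ hσ using hext
  have hfar : ∀ i j : Fin 4, ((i, j) = (0, 3) ∨ (i, j) = (0, 2) ∨ (i, j) = (1, 3)) →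
      (val i : ℕ) + (n - 2) ≤ val j := by
    rintro i j (h | h | h) <;> obtain ⟨rfl, rfl⟩ := Prod.mk.inj h <;> simp [val] <;> omega
  have hdist : ∀ x y, x ≠ y → n - 2 ≤ chebyshevDist (σ x) (σ y) := by
    intro x y hxy
    rw [le_chebyshevDist_iff hn]
    obtain ⟨i, j, hij, h | h⟩ := extremePositions_cross x y hxy
    · refine ⟨Fin.castLE hn (extremePositions x i), Or.inl ?_⟩
      rw [hσ x i, h, hσ y j]
      exact hfar i j hij
    · refine ⟨Fin.castLE hn (extremePositions y i), Or.inr ?_⟩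
      rw [hσ y i, h, hσ x j]
      exact hfar i j hij
  have hinj : Function.Injective σ := by
    intro x y hxy
    by_contra hne
    have h := hdist x y hne
    rw [hxy, le_chebyshevDist_iff hn] at h
    obtain ⟨i, hi⟩ := h
    omega
  refine ⟨Finset.univ.map ⟨σ, hinj⟩, ?_, by simp⟩
  rw [isPermArray_iff]
  intro π hπ ρ hρ hne
  obtain ⟨x, -, rfl⟩ := Finset.mem_map.1 hπ
  obtain ⟨y, -, rfl⟩ := Finset.mem_map.1 hρ
  exact hdist x y fun e => hne (by rw [e])

theorem mainTheorem4 (n : ℕ) (hn : 5 ≤ n) : maxPermArray n (n - 2) = 10 := by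
  refine (maxPermArray_isGreatest n (n - 2)).unique ⟨exists_isPermArray_card_eq_ten hn, ?_⟩
  rintro c ⟨A, hA, rfl⟩
  exact hA.card_le_ten hn
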